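/- **Signature.** Let $\mathcal S$ be a finite set of *sorts* with a fuzzy partial order ${\preceq}:\mathcal S^2\to[0,1]$: ${\preceq}(s,s)=1$; ${\preceq}(s,t)\wedge{\preceq}(t,r)\le{\preceq}(s,r)$, where $\wedge=\min$; and ${\preceq}(s,t)>0$, ${\preceq}(t,s)>0$ imply $s=t$. Write $s\preceq t$ for ${\preceq}(s,t)>0$; assume that any two sorts have a greatest lower bound $s\curlywedge t$ with respect to $s\preceq t$, and that there are sorts $\bot,\top$ with ${\preceq}(\bot,s)={\preceq}(s,\top)=1$ for all $s$. Let $\mathcal F$ be a set of *features* and $\mathcal V$ an infinite set of *variables* (tags). **Interpretations.** A *fuzzy OSF interpretation* $\mathcal I$ is a set $\Delta^{\mathcal I}$ with fuzzy subsets $s^{\mathcal I}:\Delta^{\mathcal I}\to[0,1]$ ($s\in\mathcal S$) and functions $f^{\mathcal I}:\Delta^{\mathcal I}\to\Delta^{\mathcal I}$ ($f\in\mathcal F$) such that $\top^{\mathcal I}=1$, $\bot^{\mathcal I}=0$, $s^{\mathcal I}(d)\wedge{\preceq}(s,t)\le t^{\mathcal I}(d)$, and $s^{\mathcal I}(d)\wedge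 t^{\mathcal I}(d)>0$ implies $(s\curlywedge t)^{\mathcal I}(d)>0$. For $d\in\Delta^{\mathcal I}$, $\mathcal I[d]$ is the subalgebra whose domain is the closure of $\{d\}$ under all $f^{\mathcal I}$. A *$\beta$-morphism* $\gamma:\mathcal I\to\mathcal J$ is a map $\Delta^{\mathcal I}\to\Delta^{\mathcal J}$ with $\gamma(f^{\mathcal I}(d))=f^{\mathcal J}(\gamma(d))$ and $s^{\mathcal I}(d)\wedge\beta\le s^{\mathcal J}(\gamma(d))$ for all $f,s,d$. Suprema of sets of degrees are taken in $[0,1]$ (so $\sup\emptyset=0$), and *$d$ approximates $d'$ with degree $\beta$* if $$\beta=\sup\{\beta_0\in[0,1]\mid \gamma(d)=d'\text{ for some }\beta_0\text{-morphism }\gamma:\mathcal I[d]\to\mathcal I[d']\}.$$ **Terms.** An *OSF term* is $t=X:s(f_1\to t_1,\dots,f_n\to t_n)$ with $n\ge0$, $X\in\mathcal V$, $s\in\mathcal S$, $f_i\in\mathcal F$ and OSF terms $t_i$; $X$ is its root, and $\mathrm{Tags}(t)$ is the set of variables in $t$. It is *normal* if $s\ne\bot$, the $f_i$ are pairwise distinct,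 every $t_i$ is normal, and every $Y\in\mathrm{Tags}(t)$ has at most one occurrence in $t$ at which it is the root of a subterm other than $Y:\top$. For $\alpha:\mathcal V\to\Delta^{\mathcal I}$ put $$[\![t]\!]^{\mathcal I,\alpha}(d)=\mathbf 1_{\{\alpha(X)\}}(d)\wedge s^{\mathcal I}(d)\wedge\bigwedge_i[\![t_i]\!]^{\mathcal I,\alpha}(f_i^{\mathcal I}(d)),\qquad [\![t]\!]^{\mathcal I}(d)=\sup_\alpha[\![t]\!]^{\mathcal I,\alpha}(d).$$ Write $t_1\preceq_\beta t_2$ if $\beta=\sup\{\beta_0\in[0,1]\mid\forall\mathcal I,\forall d\in\Delta^{\mathcal I}:[\![t_1]\!]^{\mathcal I}(d)\wedge\beta_0\le[\![t_2]\!]^{\mathcal I}(d)\}$. **Clauses.** A *clause* is a finite conjunction of constraints $X:s$, $X\doteq Y$, $X.f\doteq Y$. The relation $\mathcal I,\alpha\models_\beta\phi$ holds if every conjunct has degree at least $\beta$, where the degree of $X:s$ is $s^{\mathcal I}(\alpha(X))$, and that of $X\doteq Y$ (resp. $X.f\doteq Y$) is $1$ if $\alpha(Y)=\alpha(X)$ (resp.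 $\alpha(Y)=f^{\mathcal I}(\alpha(X))$) and $0$ otherwise. The clause $\phi_1$ *implies $\phi_2$ at degree $\beta$* if for all $\mathcal I$, $\alpha$, $\beta_{\mathcal I}\in[0,1]$ with $\mathcal I,\alpha\models_{\beta_{\mathcal I}}\phi_1$ there is $\alpha'$ that agrees with $\alpha$ on $\mathrm{Tags}(\phi_1)\cap\mathrm{Tags}(\phi_2)$ and satisfies $\mathcal I,\alpha'\models_{\beta_{\mathcal I}\wedge\beta}\phi_2$; and $\phi_1\models_\beta\phi_2$ means that $\beta$ is the supremum of the degrees at which $\phi_1$ implies $\phi_2$. A *rooted* clause $\phi_X$ is a clause with a distinguished variable $X$ (its root) in which every variable carries a sort constraint and is reachable from $X$ through the constraints $A.f\doteq B$. It is *solved* if it has no constraint $A\doteq B$, no constraint $A:\bot$, at most one sort constraint for each variable, and at most one constraint $A.f\doteq B$ for each $A,f$. For rooted clauses without common variables, $\phi'_X\models_\beta\phi_Y$ means $\phi'\models_\beta\phi[X/Y]$, where $\phi[X/Y]$ is $\phi$ with every $Y$ replaced by $X$. **Graphs.** An *OSF graph* $g$ is a finite directed graph with nodes in $\mathcal V$,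 a root from which every node is reachable, nodes labelled by sorts $\ne\bot$, and edges labelled by features, with at most one edge for each source and feature (parallel edges with different features are allowed). The *fuzzy OSF graph algebra* $\mathcal G$ has the OSF graphs as its domain; $s^{\mathcal G}(g)={\preceq}(\lambda,s)$ with $\lambda$ the label of the root of $g$; and $f^{\mathcal G}(g)$ is the subgraph of $g$ reachable from $Y$, rooted at $Y$, if $g$ has an edge labelled $f$ from its root to $Y$, and otherwise the graph with the single node $Z_{f,g}$, labelled $\top$, and no edges. Here $Z_{f,g}\in\mathcal V$ is a chosen variable that is not a node of $g$, and $(f,g)\mapsto Z_{f,g}$ is injective. **Correspondence.** For a normal term $\psi$ and $Y\in\mathrm{Tags}(\psi)$ let $\mathrm{Sort}_\psi(Y)$ be the most specific sort $s$ such that $Y:s$ appears in $\psi$, and write $Y\xrightarrow{f}_\psi Z$ if $f$ points in $\psi$ from a subterm with root $Y$ to a subterm with root $Z$. The graph of $\psi$ has the nodes $\mathrm{Tags}(\psi)$, the root of $\psi$, the labels $\mathrm{Sort}_\psi(Y)$ and the edges $Y\xrightarrow{f}_\psi Z$. The rooted solved clause of $\psi$ has the root of $\psi$ and the constraints $Y:\mathrm{Sort}_\psi(Y)$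 and $Y.f\doteq Z$ for $Y\xrightarrow{f}_\psi Z$. **Theorem (Equivalence of fuzzy OSF orderings).** Let $\psi,\psi'$ be normal OSF terms with roots $Y,X$ and no common variables, let $g,g'$ be their OSF graphs and $\phi_Y,\phi'_X$ their rooted solved clauses. Assume that the variables $Z_{f,h}$ are new with respect to these graphs, in the sense that for $k\in\{g,g'\}$, whenever $h$ lies in $\mathcal G[k]$ and has no edge labelled $f$ at its root, $Z_{f,h}$ is not a node of $k$. Then for every $\beta\in[0,1]$ the following are equivalent: 1. $g$ approximates $g'$ with degree $\beta$ in $\mathcal G$; 2. $\psi'\preceq_\beta\psi$; 3. $\phi'_X\models_\beta\phi_Y$. -/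

import Mathlib

universe u

namespace OSF

/-- A fuzzy bounded lattice of sorts: `sub s t` is the degree to which `s` is subsumed by `t`.
Degrees live in `[0, 1]`; the crisp relation `s ≼ t` is `0 < sub s t`. -/
class FuzzyLattice (S : Type u) where
  sub : S → S → unitInterval
  sub_refl : ∀ s, sub s s = 1
  sub_trans : ∀ s t r, sub s t ⊓ sub t r ≤ sub s r
  sub_antisymm : ∀ s t, 0 < sub s t → 0 < sub t s → s = t
  glb : S → S → S
  glb_left : ∀ s t, 0 < sub (glb s t) s
  glb_right : ∀ s t, 0 < sub (glb s t) t
  le_glb : ∀ s t r, 0 < sub r s → 0 < sub r t → 0 < sub r (glb s t)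
  bot : S
  top : S
  bot_sub : ∀ s, sub bot s = 1
  sub_top : ∀ s, sub s top = 1

open FuzzyLattice

theorem sub_bot_eq_zero {S : Type u} [FuzzyLattice S] {s : S} (hs : s ≠ bot) :
    sub s bot = 0 := by
  by_contra h
  have h1 : 0 < sub s (bot : S) := unitInterval.pos_iff_ne_zero.2 h
  exact hs (sub_antisymm _ _ h1 (by rw [bot_sub]; exact zero_lt_one))

open Classical in
/-- The value of the characteristic function of a property. -/
noncomputable def ind (p : Prop) : unitInterval := if p then 1 else 0

section Terms

/-- `node X s n f t` is the term `X : s (f 0 → t 0, …, f (n-1) → t (n-1))`;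
for `n = 0` it is the sorted variable `X : s`. -/
inductive OSFTerm (V S F : Type u) : Type u
  | node (X : V) (s : S) (n : ℕ) (f : Fin n → F) (t : Fin n → OSFTerm V S F) : OSFTerm V S F

namespace OSFTerm

variable {V S F : Type u}

def root : OSFTerm V S F → V
  | node X _ _ _ _ => X

def rootSort : OSFTerm V S F → S
  | node _ s _ _ _ => s

def tags : OSFTerm V S F → Set V
  | node X _ _ _ t => {X} ∪ ⋃ i, (t i).tags

/-- The term `X : s`. -/
def leaf (X : V) (s : S) : OSFTerm V S F := node X s 0 Fin.elim0 Fin.elim0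

/-- `SubAt t p u`: the term `u` occurs in `t` at the position `p`. -/
inductive SubAt : OSFTerm V S F → List ℕ → OSFTerm V S F → Prop
  | here (t : OSFTerm V S F) : SubAt t [] t
  | child (X : V) (s : S) (n : ℕ) (f : Fin n → F) (t : Fin n → OSFTerm V S F) (i : Fin n)
      (p : List ℕ) (u : OSFTerm V S F) : SubAt (t i) p u → SubAt (node X s n f t) (i.val :: p) u

/-- `Y : s` appears in `t`. -/
def HasSort (t : OSFTerm V S F) (Y : V) (s : S) : Prop :=
  ∃ p u, SubAt t p u ∧ u.root = Y ∧ u.rootSort = s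

/-- In `t` the feature `l` points from a subterm with root tag `Y` to a subterm with
root tag `Z`. -/
def HasEdge (t : OSFTerm V S F) (Y : V) (l : F) (Z : V) : Prop :=
  ∃ p s n f r, ∃ i : Fin n, SubAt t p (node Y s n f r) ∧ f i = l ∧ (r i).root = Z

theorem subAt_det {t : OSFTerm V S F} {p : List ℕ} {u v : OSFTerm V S F}
    (hu : SubAt t p u) (hv : SubAt t p v) : u = v := by
  induction hu with
  | here t => cases hv; rfl
  | child X s n f t i p u h ih =>
    generalize hq : i.val :: p = q at hv
    generalize ht : node X s n f t = t' at hv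
    cases hv with
    | here => simp at hq
    | child X' s' n' f' t' j p' v' h' =>
      simp only [node.injEq] at ht
      obtain ⟨rfl, rfl, rfl, ht⟩ := ht
      obtain ⟨-, ht⟩ := ht
      obtain rfl := eq_of_heq ht
      simp only [List.cons.injEq] at hq
      obtain ⟨h1, rfl⟩ := hq
      obtain rfl := Fin.ext h1
      exact ih h'

theorem mem_tags_of_subAt {t : OSFTerm V S F} {p : List ℕ} {u : OSFTerm V S F}
    (hu : SubAt t p u) : u.root ∈ t.tags := by
  induction hu with
  | here t => cases t; simp [root, tags]
  | child X s n f t i p u h ih =>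
    exact Or.inr (Set.mem_iUnion.2 ⟨i, ih⟩)

theorem exists_subAt_of_mem_tags {t : OSFTerm V S F} {Y : V} (h : Y ∈ t.tags) :
    ∃ p u, SubAt t p u ∧ u.root = Y := by
  induction t with
  | node X s n f t ih =>
    rcases h with h | h
    · exact ⟨[], _, SubAt.here _, (Set.mem_singleton_iff.1 h).symm⟩
    · obtain ⟨i, hi⟩ := Set.mem_iUnion.1 h
      obtain ⟨p, u, hu, hY⟩ := ih i hi
      exact ⟨_, u, SubAt.child X s n f t i p u hu, hY⟩

theorem root_mem_tags (t : OSFTerm V S F) : t.root ∈ t.tags :=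
  mem_tags_of_subAt (SubAt.here t)

theorem subAt_child {t : OSFTerm V S F} {p : List ℕ} {Y : V} {s : S} {n : ℕ} {f : Fin n → F}
    {r : Fin n → OSFTerm V S F} (h : SubAt t p (node Y s n f r)) (i : Fin n) :
    ∃ q, SubAt t q (r i) := by
  generalize hu : node Y s n f r = u at h
  induction h with
  | here t => subst hu; exact ⟨_, SubAt.child Y s n f r i [] _ (SubAt.here _)⟩
  | child X s n f t j p u h ih =>
    obtain ⟨q, hq⟩ := ih hu
    exact ⟨_, SubAt.child X s n f t j q _ hq⟩

theorem finite_tags (t : OSFTerm V S F) : t.tags.Finite := by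
  induction t with
  | node X s n f t ih => exact (Set.finite_singleton X).union (Set.finite_iUnion ih)

theorem finite_edges (t : OSFTerm V S F) :
    {e : V × F × V | t.HasEdge e.1 e.2.1 e.2.2}.Finite := by
  induction t with
  | node X s n f t ih =>
    refine ((Set.finite_range (fun i => (X, f i, (t i).root))).union
      (Set.finite_iUnion ih)).subset ?_
    rintro ⟨Y, l, Z⟩ ⟨p, s', n', f', r', i, h, rfl, rfl⟩
    generalize hu : node Y s' n' f' r' = u at h
    cases h with
    | here =>
      simp only [node.injEq] at hu
      obtain ⟨rfl, rfl, rfl, hf, hr⟩ := hu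
      obtain rfl := eq_of_heq hf
      obtain rfl := eq_of_heq hr
      exact Or.inl ⟨i, rfl⟩
    | child _ _ _ _ _ j p _ h =>
      subst hu
      exact Or.inr (Set.mem_iUnion.2 ⟨j, ⟨p, s', n', f', r', i, h, rfl, rfl⟩⟩)

theorem HasEdge.left_mem {t : OSFTerm V S F} {Y Z : V} {l : F} (h : t.HasEdge Y l Z) :
    Y ∈ t.tags := by
  obtain ⟨p, s, n, f, r, i, h, rfl, rfl⟩ := h
  exact mem_tags_of_subAt h

theorem HasEdge.right_mem {t : OSFTerm V S F} {Y Z : V} {l : F} (h : t.HasEdge Y l Z) :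
    Z ∈ t.tags := by
  obtain ⟨p, s, n, f, r, i, h, rfl, rfl⟩ := h
  obtain ⟨q, hq⟩ := subAt_child h i
  exact mem_tags_of_subAt hq

theorem reachable {t : OSFTerm V S F} {Y : V} (hY : Y ∈ t.tags) :
    Relation.ReflTransGen (fun A B => ∃ l, t.HasEdge A l B) t.root Y := by
  induction t with
  | node X s n f t ih =>
    rcases hY with h | h
    · obtain rfl := Set.mem_singleton_iff.1 h
      exact Relation.ReflTransGen.refl
    · obtain ⟨i, hi⟩ := Set.mem_iUnion.1 h
      refine Relation.ReflTransGen.head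
        ⟨f i, [], s, n, f, t, i, SubAt.here _, rfl, rfl⟩ ?_
      refine Relation.ReflTransGen.mono ?_ _ _ (ih i hi)
      rintro A B ⟨l, p, s', n', f', r', j, h, rfl, rfl⟩
      exact ⟨_, _, s', n', f', r', j, SubAt.child X s n f t i p _ h, rfl, rfl⟩

variable [FuzzyLattice S]

/-- Normal form. The last condition says that each tag `Y` has at most one occurrence
at which it is the root of a term different from `Y : ⊤`. -/
def IsNormal : OSFTerm V S F → Prop
  | node X s n f t =>
    s ≠ bot ∧ Function.Injective f ∧ (∀ i, (t i).IsNormal) ∧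
      ∀ Y ∈ (node X s n f t).tags, ∀ p q u v,
        SubAt (node X s n f t) p u → SubAt (node X s n f t) q v →
        u.root = Y → v.root = Y → u ≠ leaf Y top → v ≠ leaf Y top → p = q

/-- `s` is the most specific sort such that `Y : s` appears in `t`. -/
def IsSortOf (t : OSFTerm V S F) (Y : V) (s : S) : Prop :=
  t.HasSort Y s ∧ ∀ r, t.HasSort Y r → 0 < sub s r

open Classical in
/-- The most specific sort `s` such that `Y : s` appears in `t`
(by convention `⊤` for a variable that does not occur in `t`). -/
noncomputable def sortOf (t : OSFTerm V S F) (Y : V) : S :=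
  if h : ∃ s, t.IsSortOf Y s then h.choose else top

theorem isNormal_of_subAt {t : OSFTerm V S F} {p : List ℕ} {u : OSFTerm V S F}
    (hu : SubAt t p u) (ht : t.IsNormal) : u.IsNormal := by
  induction hu with
  | here t => exact ht
  | child X s n f t i p u h ih => exact ih (ht.2.2.1 i)

theorem IsNormal.occ_unique {t : OSFTerm V S F} (ht : t.IsNormal) {p q : List ℕ}
    {u v : OSFTerm V S F} (hu : SubAt t p u) (hv : SubAt t q v) (h : u.root = v.root)
    (hu' : u ≠ leaf u.root top) (hv' : v ≠ leaf v.root top) : p = q := by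
  cases t with
  | node X s n f t =>
    exact ht.2.2.2 v.root (mem_tags_of_subAt hv) p q u v hu hv h rfl (h ▸ hu') hv'

theorem IsNormal.edge_unique {t : OSFTerm V S F} (ht : t.IsNormal) {Y Z Z' : V} {l : F}
    (h : t.HasEdge Y l Z) (h' : t.HasEdge Y l Z') : Z = Z' := by
  obtain ⟨p, s, n, f, r, i, h, rfl, rfl⟩ := h
  obtain ⟨p', s', n', f', r', i', h', hf, rfl⟩ := h'
  have key : ∀ {s : S} {n : ℕ} {f : Fin n → F} {r : Fin n → OSFTerm V S F}, Fin n →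
      node Y s n f r ≠ leaf Y top := by
    intro s n f r i e
    simp only [leaf, node.injEq] at e
    obtain ⟨-, -, rfl, -⟩ := e
    exact i.elim0
  obtain rfl := ht.occ_unique h h' rfl (key i) (key i')
  have e := subAt_det h h'
  have hn := (isNormal_of_subAt h ht).2.1
  simp only [node.injEq] at e
  obtain ⟨-, rfl, rfl, e1, e2⟩ := e
  obtain rfl := eq_of_heq e1
  obtain rfl := eq_of_heq e2
  rw [hn hf]

theorem IsNormal.isSortOf_sortOf {t : OSFTerm V S F} (ht : t.IsNormal) {Y : V}
    (hY : Y ∈ t.tags) : t.IsSortOf Y (t.sortOf Y) := by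
  have hex : ∃ s, t.IsSortOf Y s := by
    by_cases h : ∃ p u, SubAt t p u ∧ u.root = Y ∧ u ≠ leaf u.root top
    · obtain ⟨p, u, hu, rfl, hne⟩ := h
      refine ⟨u.rootSort, ⟨p, u, hu, rfl, rfl⟩, ?_⟩
      rintro _ ⟨q, v, hv, hr, rfl⟩
      by_cases hv' : v = leaf v.root top
      · rw [hv']
        change 0 < sub u.rootSort top
        rw [sub_top]; exact zero_lt_one
      · obtain rfl := ht.occ_unique hu hv hr.symm hne hv'
        rw [subAt_det hu hv, sub_refl]; exact zero_lt_one
    · push Not at h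
      obtain ⟨p, u, hu, rfl⟩ := exists_subAt_of_mem_tags hY
      refine ⟨top, ⟨p, u, hu, rfl, ?_⟩, ?_⟩
      · rw [h p u hu rfl]; rfl
      · rintro _ ⟨q, v, hv, hr, rfl⟩
        rw [h q v hv hr]
        change 0 < sub top top
        rw [sub_refl]; exact zero_lt_one
  rw [sortOf, dif_pos hex]
  exact hex.choose_spec

theorem IsNormal.sortOf_ne_bot {t : OSFTerm V S F} (ht : t.IsNormal) {Y : V}
    (hY : Y ∈ t.tags) : t.sortOf Y ≠ bot := by
  obtain ⟨⟨p, u, hu, -, h⟩, -⟩ := ht.isSortOf_sortOf hY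
  rw [← h]
  have := isNormal_of_subAt hu ht
  cases u
  exact this.1

theorem sortOf_eq_top {t : OSFTerm V S F} {Y : V} (hY : Y ∉ t.tags) : t.sortOf Y = top := by
  rw [sortOf, dif_neg]
  rintro ⟨s, ⟨p, u, hu, rfl, -⟩, -⟩
  exact hY (mem_tags_of_subAt hu)

end OSFTerm

end Terms

/-- The set `Ψ` of normal OSF terms. -/
def NormalTerm (V S F : Type u) [FuzzyLattice S] : Type u :=
  {t : OSFTerm V S F // t.IsNormal}

section Clauses

inductive OSFConstraint (V S F : Type u) : Type u
  /-- `X : s` -/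
  | sort (X : V) (s : S) : OSFConstraint V S F
  /-- `X ≐ Y` -/
  | eq (X Y : V) : OSFConstraint V S F
  /-- `X.f ≐ Y` -/
  | feat (X : V) (f : F) (Y : V) : OSFConstraint V S F

namespace OSFConstraint

variable {V S F : Type u}

def tags : OSFConstraint V S F → Set V
  | sort X _ => {X}
  | eq X Y => {X, Y}
  | feat X _ Y => {X, Y}

def mapTags (σ : V → V) : OSFConstraint V S F → OSFConstraint V S F
  | sort X s => sort (σ X) s
  | eq X Y => eq (σ X) (σ Y)
  | feat X f Y => feat (σ X) f (σ Y)

end OSFConstraint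

/-- A clause is a conjunction of constraints, represented by the finite set of its conjuncts. -/
abbrev Clause (V S F : Type u) : Type u := Finset (OSFConstraint V S F)

namespace Clause

variable {V S F : Type u}

def tags (φ : Clause V S F) : Set V := ⋃ c ∈ φ, c.tags

open Classical in
/-- `φ.subst X Y` is `φ[X/Y]`: all occurrences of `Y` are replaced with `X`. -/
noncomputable def subst (φ : Clause V S F) (X Y : V) : Clause V S F :=
  φ.image (OSFConstraint.mapTags (fun Z => if Z = Y then X else Z))

/-- The reachability relation of a clause. -/
def Reach (φ : Clause V S F) : V → V → Prop :=
  Relation.ReflTransGen (fun A B => ∃ f, OSFConstraint.feat A f B ∈ φ)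

/-- Solved form. -/
def IsSolved [FuzzyLattice S] (φ : Clause V S F) : Prop :=
  (∀ X s, OSFConstraint.sort X s ∈ φ →
      s ≠ bot ∧ ∀ r, OSFConstraint.sort X r ∈ φ → r = s) ∧
    (∀ X f Y Z, OSFConstraint.feat X f Y ∈ φ → OSFConstraint.feat X f Z ∈ φ → Y = Z) ∧
    ∀ X Y, OSFConstraint.eq X Y ∉ φ

end Clause

/-- A rooted clause. -/
structure RootedClause (V S F : Type u) where
  clause : Clause V S F
  root : V
  root_mem : root ∈ clause.tags
  sorted : ∀ Y ∈ clause.tags, ∃ s, OSFConstraint.sort Y s ∈ clause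
  reachable : ∀ Y ∈ clause.tags, clause.Reach root Y

/-- The set `Φ_R` of rooted solved clauses. -/
structure RootedSolvedClause (V S F : Type u) [FuzzyLattice S] extends RootedClause V S F where
  solved : clause.IsSolved

/-- The set of constraints `Y : Sort_ψ(Y)` for the tags `Y` of `ψ` and `Y.f ≐ Z` for the arrows
`Y → Z` of `ψ` labelled `f`. -/
def OSFTerm.constraintSet {V S F : Type u} [FuzzyLattice S] (t : OSFTerm V S F) :
    Set (OSFConstraint V S F) :=
  {c | (∃ Y ∈ t.tags, c = .sort Y (t.sortOf Y)) ∨ ∃ Y f Z, t.HasEdge Y f Z ∧ c = .feat Y f Z}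

theorem OSFTerm.finite_constraintSet {V S F : Type u} [FuzzyLattice S] (t : OSFTerm V S F) :
    t.constraintSet.Finite := by
  refine ((t.finite_tags.image (fun Y => OSFConstraint.sort Y (t.sortOf Y))).union
    (t.finite_edges.image (fun e => OSFConstraint.feat e.1 e.2.1 e.2.2))).subset ?_
  rintro c (⟨Y, hY, rfl⟩ | ⟨Y, f, Z, h, rfl⟩)
  · exact Or.inl ⟨Y, hY, rfl⟩
  · exact Or.inr ⟨(Y, f, Z), h, rfl⟩

/-- The clause of a normal term. -/
noncomputable def OSFTerm.clauseOf {V S F : Type u} [FuzzyLattice S] (t : OSFTerm V S F) :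
    Clause V S F :=
  t.finite_constraintSet.toFinset

theorem OSFTerm.mem_clauseOf {V S F : Type u} [FuzzyLattice S] {t : OSFTerm V S F}
    {c : OSFConstraint V S F} :
    c ∈ t.clauseOf ↔ (∃ Y ∈ t.tags, c = .sort Y (t.sortOf Y)) ∨
      ∃ Y f Z, t.HasEdge Y f Z ∧ c = .feat Y f Z := by
  rw [OSFTerm.clauseOf, Set.Finite.mem_toFinset]
  rfl

theorem OSFTerm.tags_clauseOf {V S F : Type u} [FuzzyLattice S] (t : OSFTerm V S F) :
    t.clauseOf.tags = t.tags := by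
  ext Y
  simp only [Clause.tags, Set.mem_iUnion, exists_prop]
  constructor
  · rintro ⟨c, hc, hY⟩
    rcases OSFTerm.mem_clauseOf.1 hc with ⟨Z, hZ, rfl⟩ | ⟨A, f, B, h, rfl⟩
    · obtain rfl : Y = Z := hY
      exact hZ
    · rcases hY with rfl | hY
      · exact h.left_mem
      · obtain rfl : Y = B := hY
        exact h.right_mem
  · intro hY
    exact ⟨_, OSFTerm.mem_clauseOf.2 (Or.inl ⟨Y, hY, rfl⟩), rfl⟩

/-- The map from normal terms to rooted solved clauses. -/
noncomputable def NormalTerm.toClause {V S F : Type u} [FuzzyLattice S]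
    (ψ : NormalTerm V S F) : RootedSolvedClause V S F where
  clause := ψ.1.clauseOf
  root := ψ.1.root
  root_mem := by rw [OSFTerm.tags_clauseOf]; exact ψ.1.root_mem_tags
  sorted := by
    intro Y hY
    rw [OSFTerm.tags_clauseOf] at hY
    exact ⟨_, OSFTerm.mem_clauseOf.2 (Or.inl ⟨Y, hY, rfl⟩)⟩
  reachable := by
    intro Y hY
    rw [OSFTerm.tags_clauseOf] at hY
    refine Relation.ReflTransGen.mono ?_ _ _ (OSFTerm.reachable hY)
    rintro A B ⟨f, h⟩
    exact ⟨f, OSFTerm.mem_clauseOf.2 (Or.inr ⟨A, f, B, h, rfl⟩)⟩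
  solved := by
    refine ⟨?_, ?_, ?_⟩
    · intro X s h
      have key : ∀ r, OSFConstraint.sort X r ∈ ψ.1.clauseOf →
          X ∈ ψ.1.tags ∧ r = ψ.1.sortOf X := by
        intro r hr
        rcases OSFTerm.mem_clauseOf.1 hr with ⟨Y, hY, e⟩ | ⟨A, f, B, -, e⟩
        · simp only [OSFConstraint.sort.injEq] at e
          obtain ⟨rfl, rfl⟩ := e
          exact ⟨hY, rfl⟩
        · cases e
      refine ⟨?_, fun r hr => (key r hr).2.trans (key s h).2.symm⟩
      rw [(key s h).2]
      exact ψ.2.sortOf_ne_bot (key s h).1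
    · intro X f Y Z h h'
      have key : ∀ W, OSFConstraint.feat X f W ∈ ψ.1.clauseOf → ψ.1.HasEdge X f W := by
        intro W hW
        rcases OSFTerm.mem_clauseOf.1 hW with ⟨Y, hY, e⟩ | ⟨A, f, B, h, e⟩
        · cases e
        · cases e
          exact h
      exact ψ.2.edge_unique (key _ h) (key _ h')
    · intro X Y h
      rcases OSFTerm.mem_clauseOf.1 h with ⟨Y, hY, e⟩ | ⟨A, f, B, h, e⟩ <;> cases e

end Clauses

section Graphs

/-- An OSF graph with nodes in `V`. Graphs are finite, like the terms that they correspond to.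
An edge is a triple (source, feature, target), so two nodes may be joined by several edges with
different features. The labelling is a function on the nodes; it is given the value `⊤` outside
of the nodes, so that equal graphs are equal as structures. -/
@[ext]
structure OSFGraph (V S F : Type u) [FuzzyLattice S] where
  nodes : Set V
  edges : Set (V × F × V)
  label : V → S
  root : V
  finite_nodes : nodes.Finite
  finite_edges : edges.Finite
  edges_mem : ∀ Y f Z, (Y, f, Z) ∈ edges → Y ∈ nodes ∧ Z ∈ nodes
  edges_unique : ∀ Y f Z Z', (Y, f, Z) ∈ edges → (Y, f, Z') ∈ edges → Z = Z'
  label_ne_bot : ∀ Y ∈ nodes, label Y ≠ bot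
  label_off : ∀ Y ∉ nodes, label Y = top
  root_mem : root ∈ nodes
  reachable : ∀ Y ∈ nodes, Relation.ReflTransGen (fun A B => ∃ f, (A, f, B) ∈ edges) root Y

/-- The map from normal terms to OSF graphs. -/
noncomputable def NormalTerm.toGraph {V S F : Type u} [FuzzyLattice S]
    (ψ : NormalTerm V S F) : OSFGraph V S F where
  nodes := ψ.1.tags
  edges := {e | ψ.1.HasEdge e.1 e.2.1 e.2.2}
  label := ψ.1.sortOf
  root := ψ.1.root
  finite_nodes := ψ.1.finite_tags
  finite_edges := ψ.1.finite_edges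
  edges_mem _ _ _ h := ⟨OSFTerm.HasEdge.left_mem h, OSFTerm.HasEdge.right_mem h⟩
  edges_unique _ _ _ _ h h' := ψ.2.edge_unique h h'
  label_ne_bot _ hY := ψ.2.sortOf_ne_bot hY
  label_off _ hY := OSFTerm.sortOf_eq_top hY
  root_mem := ψ.1.root_mem_tags
  reachable _ hY := OSFTerm.reachable hY

namespace OSFGraph

variable {V S F : Type u} [FuzzyLattice S]

def Reach (g : OSFGraph V S F) : V → V → Prop :=
  Relation.ReflTransGen (fun A B => ∃ f, (A, f, B) ∈ g.edges)

theorem Reach.mem {g : OSFGraph V S F} {Y Z : V} (h : g.Reach Y Z) (hY : Y ∈ g.nodes) :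
    Z ∈ g.nodes := by
  induction h with
  | refl => exact hY
  | tail _ h _ =>
    obtain ⟨f, h⟩ := h
    exact (g.edges_mem _ _ _ h).2

open Classical in
/-- The maximally connected subgraph of `g` rooted at the node `Y`. -/
noncomputable def restrict (g : OSFGraph V S F) (Y : V) (hY : Y ∈ g.nodes) :
    OSFGraph V S F where
  nodes := {Z | g.Reach Y Z}
  edges := {e | e ∈ g.edges ∧ g.Reach Y e.1}
  label Z := if g.Reach Y Z then g.label Z else top
  root := Y
  finite_nodes := g.finite_nodes.subset fun _ h => Reach.mem h hY
  finite_edges := g.finite_edges.subset fun _ h => h.1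
  edges_mem := fun _ f _ h => ⟨h.2, Relation.ReflTransGen.tail h.2 ⟨f, h.1⟩⟩
  edges_unique := fun _ _ _ _ h h' => g.edges_unique _ _ _ _ h.1 h'.1
  label_ne_bot := by
    intro Z hZ
    have hZ' : g.Reach Y Z := hZ
    rw [if_pos hZ']
    exact g.label_ne_bot Z (Reach.mem hZ' hY)
  label_off := fun Z hZ => if_neg hZ
  root_mem := Relation.ReflTransGen.refl
  reachable := by
    intro Z hZ
    have hZ' : g.Reach Y Z := hZ
    change Relation.ReflTransGen _ Y Z
    induction hZ' with
    | refl => exact Relation.ReflTransGen.refl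
    | tail h1 h2 ih =>
      obtain ⟨f, h2⟩ := h2
      exact (ih h1).tail ⟨f, h2, h1⟩

/-- The trivial graph: a single node `Z` labelled `⊤`, where `⊤` is not the bottom sort. -/
def trivialGraph (Z : V) (h : (top : S) ≠ bot) : OSFGraph V S F where
  nodes := {Z}
  edges := ∅
  label _ := top
  root := Z
  finite_nodes := Set.finite_singleton Z
  finite_edges := Set.finite_empty
  edges_mem := fun _ _ _ h => h.elim
  edges_unique := fun _ _ _ _ h => h.elim
  label_ne_bot := fun _ _ => h
  label_off := fun _ _ => rfl
  root_mem := rfl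
  reachable := by
    intro Y hY
    obtain rfl : Y = Z := hY
    exact Relation.ReflTransGen.refl

theorem top_ne_bot (g : OSFGraph V S F) : (top : S) ≠ bot := by
  intro h
  refine g.label_ne_bot _ g.root_mem (sub_antisymm _ _ ?_ ?_)
  · rw [← h, sub_top]; exact zero_lt_one
  · rw [bot_sub]; exact zero_lt_one

end OSFGraph

/-- A choice of the new variables `Z_{f,g}` that serve as the nodes of trivial graphs: each one
is not a node of `g`, and distinct pairs `(f, g)` have distinct new variables. -/
structure NewTags (V S F : Type u) [FuzzyLattice S] where
  tag : F → OSFGraph V S F → V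
  tag_notMem : ∀ f g, tag f g ∉ g.nodes
  tag_inj : ∀ f g f' g', tag f g = tag f' g' → f = f' ∧ g = g'

end Graphs

/-- A fuzzy OSF interpretation. -/
structure Interp (S F : Type u) [FuzzyLattice S] where
  Dom : Type u
  sort : S → Dom → unitInterval
  feat : F → Dom → Dom
  sort_top : ∀ d, sort top d = 1
  sort_bot : ∀ d, sort bot d = 0
  sort_sub : ∀ s t d, sort s d ⊓ sub s t ≤ sort t d
  sort_glb : ∀ s t d, 0 < sort s d ⊓ sort t d → 0 < sort (glb s t) d

namespace Interp

variable {S F : Type u} [FuzzyLattice S]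

/-- The composition `f_n ∘ … ∘ f_1` of the functions that interpret `w = f_1 … f_n`. -/
def word (I : Interp S F) (w : List F) (d : I.Dom) : I.Dom :=
  w.foldl (fun e f => I.feat f e) d

/-- The closure of a set under feature application. -/
def closure (I : Interp S F) (D : Set I.Dom) : Set I.Dom :=
  {e | ∃ w, ∃ d ∈ D, e = I.word w d}

theorem subset_closure (I : Interp S F) (D : Set I.Dom) : D ⊆ I.closure D :=
  fun d hd => ⟨[], d, hd, rfl⟩

theorem feat_mem_closure (I : Interp S F) (D : Set I.Dom) (f : F) {e : I.Dom}
    (he : e ∈ I.closure D) : I.feat f e ∈ I.closure D := by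
  obtain ⟨w, d, hd, rfl⟩ := he
  exact ⟨w ++ [f], d, hd, by simp [word]⟩

/-- The subalgebra `I[D]` generated by `D`. -/
def generated (I : Interp S F) (D : Set I.Dom) : Interp S F where
  Dom := I.closure D
  sort s d := I.sort s d.1
  feat f d := ⟨I.feat f d.1, I.feat_mem_closure D f d.2⟩
  sort_top d := I.sort_top d.1
  sort_bot d := I.sort_bot d.1
  sort_sub s t d := I.sort_sub s t d.1
  sort_glb s t d := I.sort_glb s t d.1

/-- The element `d` of `I[d]`. -/
def gen (I : Interp S F) (d : I.Dom) : (I.generated {d}).Dom :=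
  ⟨d, I.subset_closure {d} rfl⟩

/-- `γ` is a `β`-morphism. -/
def IsMorphism (I J : Interp S F) (β : unitInterval) (γ : I.Dom → J.Dom) : Prop :=
  (∀ f d, γ (I.feat f d) = J.feat f (γ d)) ∧ ∀ s d, I.sort s d ⊓ β ≤ J.sort s (γ d)

/-- The degree to which `d` approximates `d'`. -/
noncomputable def approx (I : Interp S F) (d d' : I.Dom) : unitInterval :=
  sSup {β | ∃ γ : (I.generated {d}).Dom → (I.generated {d'}).Dom,
    IsMorphism (I.generated {d}) (I.generated {d'}) β γ ∧ γ (I.gen d) = I.gen d'}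

/-- The denotation of a term under an assignment. -/
noncomputable def denotAt {V : Type u} (I : Interp S F) (α : V → I.Dom) :
    OSFTerm V S F → I.Dom → unitInterval
  | .node X s _ f t => fun d =>
      ind (d = α X) ⊓ I.sort s d ⊓ ⨅ i, denotAt I α (t i) (I.feat (f i) d)

/-- The denotation of a term. -/
noncomputable def denot {V : Type u} (I : Interp S F) (t : OSFTerm V S F) (d : I.Dom) :
    unitInterval :=
  ⨆ α : V → I.Dom, I.denotAt α t d

/-- Graded satisfaction of a constraint. -/
def SatConstraint {V : Type u} (I : Interp S F) (α : V → I.Dom) (β : unitInterval) :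
    OSFConstraint V S F → Prop
  | .sort X s => β ≤ I.sort s (α X)
  | .eq X Y => β ≤ ind (α Y = α X)
  | .feat X f Y => β ≤ ind (α Y = I.feat f (α X))

/-- Graded satisfaction of a clause. -/
def Sat {V : Type u} (I : Interp S F) (α : V → I.Dom) (β : unitInterval)
    (φ : Clause V S F) : Prop :=
  ∀ c ∈ φ, I.SatConstraint α β c

end Interp

section Orders

variable {V S F : Type u} [FuzzyLattice S]

open Classical in
/-- The fuzzy OSF graph algebra, for a given choice of new variables. -/
noncomputable def graphAlgebra (Z : NewTags V S F) : Interp S F where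
  Dom := OSFGraph V S F
  sort s g := sub (g.label g.root) s
  feat f g :=
    if h : ∃ Y, (g.root, f, Y) ∈ g.edges then
      g.restrict h.choose (g.edges_mem _ _ _ h.choose_spec).2
    else OSFGraph.trivialGraph (Z.tag f g) g.top_ne_bot
  sort_top _ := sub_top _
  sort_bot g := sub_bot_eq_zero (g.label_ne_bot _ g.root_mem)
  sort_sub _ _ _ := sub_trans _ _ _
  sort_glb s t _ h := le_glb s t _ (lt_of_lt_of_le h inf_le_left) (lt_of_lt_of_le h inf_le_right)

/-- The new variables that are introduced when features are applied in the subalgebra of the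
graph algebra generated by `g` are new with respect to `g`, i.e. they are not nodes of `g`. -/
def NewTags.NewFor (Z : NewTags V S F) (g : OSFGraph V S F) : Prop :=
  ∀ h ∈ (graphAlgebra Z).closure {g}, ∀ f, (¬ ∃ Y, (h.root, f, Y) ∈ h.edges) →
    Z.tag f h ∉ g.nodes

/-- The degree to which the term `t₁` is subsumed by the term `t₂`. -/
noncomputable def termSub (t₁ t₂ : OSFTerm V S F) : unitInterval :=
  sSup {β | ∀ (I : Interp S F) (d : I.Dom), I.denot t₁ d ⊓ β ≤ I.denot t₂ d}

/-- `φ₁` implies `φ₂` at degree `β`. -/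
def ImpliesAt (φ₁ φ₂ : Clause V S F) (β : unitInterval) : Prop :=
  ∀ (I : Interp S F) (α : V → I.Dom) (βI : unitInterval), I.Sat α βI φ₁ →
    ∃ α' : V → I.Dom, (∀ X ∈ φ₁.tags ∩ φ₂.tags, α' X = α X) ∧ I.Sat α' (βI ⊓ β) φ₂

/-- The degree to which `φ₁` implies `φ₂`. -/
noncomputable def clauseImpl (φ₁ φ₂ : Clause V S F) : unitInterval :=
  sSup {β | ImpliesAt φ₁ φ₂ β}

/-- The degree to which the rooted clause `φ₁` implies the rooted clause `φ₂`
(for clauses without common variables): the root of `φ₂` is first replaced by that of `φ₁`. -/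
noncomputable def rootedImpl (φ₁ φ₂ : RootedClause V S F) : unitInterval :=
  clauseImpl φ₁.clause (φ₂.clause.subst φ₁.root φ₂.root)

end Orders

section Existence

theorem OSFGraph.countable (V S F : Type u) [FuzzyLattice S] [Countable V] [Finite S]
    [Countable F] : Countable (OSFGraph V S F) := by
  let e : OSFGraph V S F → Finset V × Finset (V × F × V) × Finset (V × S) × V := fun g =>
    (g.finite_nodes.toFinset, g.finite_edges.toFinset,
      (g.finite_nodes.image (fun Y => (Y, g.label Y))).toFinset, g.root)
  refine Function.Injective.countable (f := e) ?_
  intro g g' h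
  simp only [e, Prod.mk.injEq] at h
  obtain ⟨h1, h2, h3, h4⟩ := h
  have h1' : g.nodes = g'.nodes := by simpa using h1
  have h2' : g.edges = g'.edges := by simpa using h2
  refine OSFGraph.ext h1' h2' ?_ h4
  funext Y
  by_cases hY : Y ∈ g.nodes
  · have : (Y, g.label Y) ∈ (g.finite_nodes.image (fun Y => (Y, g.label Y))).toFinset := by
      rw [Set.Finite.mem_toFinset]
      exact ⟨Y, hY, rfl⟩
    rw [h3, Set.Finite.mem_toFinset] at this
    obtain ⟨Y', -, h⟩ := this
    simp only [Prod.mk.injEq] at h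
    obtain ⟨rfl, h⟩ := h
    exact h.symm
  · rw [g.label_off Y hY, g'.label_off Y (h1' ▸ hY)]

/-- For countably many features and a countably infinite set of variables there is a choice of
new variables that avoids any given finite set of variables. -/
theorem NewTags.exists_avoiding (V S F : Type u) [FuzzyLattice S] [Countable V] [Infinite V]
    [Finite S] [Countable F] (A : Set V) (hA : A.Finite) :
    ∃ Z : NewTags V S F, ∀ f g, Z.tag f g ∉ A := by
  have := OSFGraph.countable V S F
  obtain ⟨c, hc⟩ := exists_injective_nat (F × OSFGraph V S F)
  obtain ⟨v⟩ : Nonempty (V ≃ ℕ) := by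
    obtain ⟨d⟩ := nonempty_denumerable V
    exact ⟨Denumerable.eqv V⟩
  have hb : ∀ g : OSFGraph V S F, ∃ k, ∀ Y ∈ g.nodes ∪ A, v Y < k := by
    intro g
    obtain ⟨k, hk⟩ := ((g.finite_nodes.union hA).image v).bddAbove
    exact ⟨k + 1, fun Y hY => Nat.lt_succ_of_le (hk ⟨Y, hY, rfl⟩)⟩
  choose k hk using hb
  have key : ∀ f g, v.symm (Nat.pair (c (f, g)) (k g)) ∉ g.nodes ∪ A := by
    intro f g h
    have := hk g _ h
    rw [Equiv.apply_symm_apply] at this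
    exact absurd (Nat.right_le_pair (c (f, g)) (k g)) (not_le.2 this)
  refine ⟨⟨fun f g => v.symm (Nat.pair (c (f, g)) (k g)), fun _ _ h => key _ _ (Or.inl h), ?_⟩,
    fun _ _ h => key _ _ (Or.inr h)⟩
  intro f g f' g' h
  have h' := hc (Nat.pair_eq_pair.1 (v.symm.injective h)).1
  simpa using h'

end Existence

end OSF

/-! ### Positive degrees, suprema and substituted tags -/

namespace OSF

open FuzzyLattice

/-! All three degrees are suprema of sets of degrees, and the sets have the same positive members;
hence the suprema coincide (`sSup_eq_of_pos`). Positive degrees turn the 0-1 valued conditions on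
tags and features into true equations.

The common notion is `Interp.Solves`: an assignment that respects the edges of a graph and gives
every node its label to degree at least `β`. Three things are expressed by solutions of the graph of
`ψ` whose root has value `d`. The first is the `β`-morphisms from the subalgebra generated by the
graph, sending the graph to `d`: this is a freeness property (`hasMorphism_iff_exists_solves`) and
the only place where newness of the tags is needed. The second is `ψ` having denotation at least `β`
at `d` (`NormalTerm.le_denot_iff`). The third is satisfaction of the clause of `ψ` with its root at
`d` (`NormalTerm.sat_toClause_iff`).

Given this, one argument serves for terms and clauses. A subsumption or implication, tested in the
graph algebra on the generic instance `g'`, whose identity morphism has degree 1, yields a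
`β`-morphism from `g` to `g'`. Conversely, such a morphism, composed with the morphism from `g'`
that encodes a solution of `g'` in an arbitrary interpretation, gives a solution of `g` there, and
degrees combine by minimum. -/

theorem le_ind_iff {β : unitInterval} (hβ : 0 < β) {p : Prop} : β ≤ ind p ↔ p := by
  by_cases hp : p
  · simp only [ind, hp, if_true, iff_true]
    exact unitInterval.le_one'
  · simp only [ind, hp, if_false, iff_false, not_le]
    exact hβ

/-- Since `sSup ∅ = 0`, membership of degree 0 never affects a supremum in the unit interval. -/
theorem sSup_eq_of_pos {A B : Set unitInterval} (h : ∀ β, 0 < β → (β ∈ A ↔ β ∈ B)) :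
    sSup A = sSup B := by
  have key : ∀ {A B : Set unitInterval}, (∀ β, 0 < β → (β ∈ A ↔ β ∈ B)) →
      sSup A ≤ sSup B := by
    intro A B h
    refine sSup_le fun β hβ => ?_
    rcases eq_or_lt_of_le (unitInterval.nonneg' (t := β)) with h0 | h0
    · rw [← h0]; exact unitInterval.nonneg'
    · exact le_sSup ((h β h0).1 hβ)
  exact le_antisymm (key h) (key fun β hβ => (h β hβ).symm)

/-- Serves to show that two clauses with disjoint tags share at most the root after the roots are
identified. -/
theorem Clause.mem_tags_subst {V S F : Type u} {φ : Clause V S F} {X Y A : V} (h : A ∈ (φ.subst X Y).tags) :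
    A = X ∨ A ∈ φ.tags := by
  classical
  simp only [Clause.tags, Clause.subst, Set.mem_iUnion, exists_prop, Finset.mem_image] at h ⊢
  obtain ⟨_, ⟨c, hc, rfl⟩, hA⟩ := h
  have key : ∀ B ∈ c.tags, A = (if B = Y then X else B) → A = X ∨ ∃ c ∈ φ, A ∈ c.tags := by
    intro B hB hAB
    split_ifs at hAB
    · exact Or.inl hAB
    · exact Or.inr ⟨c, hc, hAB ▸ hB⟩
  cases c with
  | sort B s => exact key B rfl hA
  | eq B C =>
    rcases hA with hA | hA
    · exact key B (Or.inl rfl) hA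
    · exact key C (Or.inr rfl) hA
  | feat B f C =>
    rcases hA with hA | hA
    · exact key B (Or.inl rfl) hA
    · exact key C (Or.inr rfl) hA

/-! ### Morphisms between generated subalgebras -/

namespace Interp

variable {S F : Type u} [FuzzyLattice S]

theorem word_append_singleton (I : Interp S F) (w : List F) (f : F) (d : I.Dom) :
    I.word (w ++ [f]) d = I.feat f (I.word w d) := by
  simp [word]

theorem word_mem_closure (I : Interp S F) (w : List F) (d : I.Dom) :
    I.word w d ∈ I.closure {d} :=
  ⟨w, d, rfl, rfl⟩

/-- Trivial graphs have a sort `s` to degree exactly `sub top s`, so this makes them impose no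
condition on the image of a morphism. -/
theorem sub_top_le_sort (I : Interp S F) (s : S) (d : I.Dom) : sub top s ≤ I.sort s d := by
  have h := I.sort_sub top s d
  rw [I.sort_top] at h
  exact le_trans (le_inf unitInterval.le_one' le_rfl) h

/-- There is a `β`-morphism `I[d] → J[e]` that maps `d` to `e`. -/
def HasMorphism (I J : Interp S F) (d : I.Dom) (e : J.Dom) (β : unitInterval) : Prop :=
  ∃ γ : (I.generated {d}).Dom → (J.generated {e}).Dom,
    IsMorphism (I.generated {d}) (J.generated {e}) β γ ∧ γ (I.gen d) = J.gen e

theorem HasMorphism.refl (I : Interp S F) (d : I.Dom) (β : unitInterval) :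
    HasMorphism I I d d β :=
  ⟨id, ⟨fun _ _ => rfl, fun _ _ => inf_le_left⟩, rfl⟩

theorem HasMorphism.trans {I J K : Interp S F} {d : I.Dom} {e : J.Dom} {k : K.Dom}
    {β δ : unitInterval} (h : HasMorphism I J d e β) (h' : HasMorphism J K e k δ) :
    HasMorphism I K d k (β ⊓ δ) := by
  obtain ⟨γ, ⟨h1, h2⟩, h3⟩ := h
  obtain ⟨γ', ⟨h1', h2'⟩, h3'⟩ := h'
  refine ⟨γ' ∘ γ, ⟨fun f x => ?_, fun s x => ?_⟩, ?_⟩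
  · simp only [Function.comp_apply, h1, h1']
  · rw [← inf_assoc]
    exact (inf_le_inf_right δ (h2 s x)).trans (h2' s (γ x))
  · simp only [Function.comp_apply, h3, h3']

/-- Every element of `I[d]` is the value at `d` of some word of features, so a morphism sending `d`
to `e` has to send the value of a word at `d` to its value at `e`. The hypothesis `hw` is
well-definedness of this map. -/
theorem HasMorphism.of_word {I J : Interp S F} {d : I.Dom} {e : J.Dom} {β : unitInterval}
    (hw : ∀ w w', I.word w d = I.word w' d → J.word w e = J.word w' e)
    (hs : ∀ w s, I.sort s (I.word w d) ⊓ β ≤ J.sort s (J.word w e)) :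
    HasMorphism I J d e β := by
  have hex : ∀ x : (I.generated {d}).Dom, ∃ w, x.1 = I.word w d := by
    rintro ⟨x, w, d', rfl, h⟩
    exact ⟨w, h⟩
  -- An arbitrary representing word for each element; `hw` makes the choice irrelevant.
  choose v hv using hex
  refine ⟨fun x => ⟨J.word (v x) e, J.word_mem_closure _ _⟩, ⟨fun f x => ?_, fun s x => ?_⟩, ?_⟩
  · refine Subtype.ext ?_
    change J.word _ e = J.feat f (J.word _ e)
    rw [← word_append_singleton]
    refine hw _ _ ?_
    rw [← hv, word_append_singleton, ← hv]
    rfl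
  · change I.sort s x.1 ⊓ β ≤ J.sort s (J.word _ e)
    rw [hv x]
    exact hs _ s
  · refine Subtype.ext (hw _ [] ?_)
    rw [← hv]
    rfl

/-- The assignment `α` maps the edges of the graph `g` to feature applications, and each of its
nodes to an element that has the label of the node as a sort to degree at least `β`. -/
def Solves {V : Type u} (I : Interp S F) (α : V → I.Dom) (β : unitInterval)
    (g : OSFGraph V S F) : Prop :=
  (∀ Y f Z, (Y, f, Z) ∈ g.edges → α Z = I.feat f (α Y)) ∧
    ∀ Y ∈ g.nodes, β ≤ I.sort (g.label Y) (α Y)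

end Interp

/-! ### Subgraphs rooted at a node -/

namespace OSFGraph

variable {V S F : Type u} [FuzzyLattice S]

theorem reach_restrict_iff {g : OSFGraph V S F} {Y A B : V} (hY : Y ∈ g.nodes)
    (hA : g.Reach Y A) : (g.restrict Y hY).Reach A B ↔ g.Reach A B := by
  constructor
  · refine Relation.ReflTransGen.mono ?_ A B
    rintro C D ⟨f, h⟩
    exact ⟨f, h.1⟩
  · intro h
    induction h with
    | refl => exact Relation.ReflTransGen.refl
    | tail h1 h2 ih =>
      obtain ⟨f, h2⟩ := h2
      exact ih.tail ⟨f, h2, hA.trans h1⟩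

/-- Keeps iterated feature application along edges of `g` inside the family of subgraphs `g.restrict
Y`. -/
theorem restrict_restrict {g : OSFGraph V S F} {Y A : V} (hY : Y ∈ g.nodes)
    (hA : g.Reach Y A) (hA' : A ∈ (g.restrict Y hY).nodes) :
    (g.restrict Y hY).restrict A hA' = g.restrict A (hA.mem hY) := by
  refine OSFGraph.ext ?_ ?_ ?_ rfl
  · ext B
    exact reach_restrict_iff hY hA
  · ext e
    change ((e ∈ g.edges ∧ g.Reach Y e.1) ∧ (g.restrict Y hY).Reach A e.1) ↔
      e ∈ g.edges ∧ g.Reach A e.1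
    rw [reach_restrict_iff hY hA]
    exact ⟨fun h => ⟨h.1.1, h.2⟩, fun h => ⟨⟨h.1, hA.trans h.2⟩, h.2⟩⟩
  · funext B
    have hr := reach_restrict_iff (B := B) hY hA
    by_cases h : g.Reach A B
    · exact (if_pos (hr.2 h)).trans ((if_pos (hA.trans h)).trans (if_pos h).symm)
    · exact (if_neg (mt hr.1 h)).trans (if_neg h).symm

theorem restrict_root (g : OSFGraph V S F) : g.restrict g.root g.root_mem = g := by
  refine OSFGraph.ext ?_ ?_ ?_ rfl
  · ext B
    exact ⟨fun h => Reach.mem h g.root_mem, fun h => g.reachable B h⟩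
  · ext ⟨A, f, B⟩
    exact ⟨fun h => h.1, fun h => ⟨h, g.reachable A (g.edges_mem _ _ _ h).1⟩⟩
  · funext B
    simp only [restrict]
    by_cases h : g.Reach g.root B
    · rw [if_pos h]
    · rw [if_neg h, g.label_off]
      exact fun hB => h (g.reachable B hB)

theorem label_restrict_root (g : OSFGraph V S F) {Y : V} (hY : Y ∈ g.nodes) :
    (g.restrict Y hY).label (g.restrict Y hY).root = g.label Y :=
  if_pos Relation.ReflTransGen.refl

end OSFGraph

/-! ### Freeness of the subalgebra generated by a graph -/

section GraphAlgebra

variable {V S F : Type u} [FuzzyLattice S] (Z : NewTags V S F)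

/-- The target chosen in the definition is forced, because a source and a feature determine the
edge. -/
theorem graphAlgebra_feat_of_edge {g : OSFGraph V S F} {Y : V} {f : F}
    (h : (g.root, f, Y) ∈ g.edges) :
    (graphAlgebra Z).feat f g = g.restrict Y (g.edges_mem _ _ _ h).2 := by
  have hex : ∃ Y, (g.root, f, Y) ∈ g.edges := ⟨Y, h⟩
  have heq : hex.choose = Y := g.edges_unique _ _ _ _ hex.choose_spec h
  simp only [graphAlgebra, dif_pos hex]
  congr 1

theorem graphAlgebra_feat_of_not_edge {g : OSFGraph V S F} {f : F}
    (h : ¬ ∃ Y, (g.root, f, Y) ∈ g.edges) :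
    (graphAlgebra Z).feat f g = OSFGraph.trivialGraph (Z.tag f g) g.top_ne_bot := by
  simp only [graphAlgebra, dif_neg h]

/-- Says that `Y ↦ g.restrict Y` respects the edges of `g`: it is the generic solution of `g`. -/
theorem graphAlgebra_feat_restrict {g : OSFGraph V S F} {Y A : V} {f : F}
    (h : (Y, f, A) ∈ g.edges) :
    (graphAlgebra Z).feat f (g.restrict Y (g.edges_mem _ _ _ h).1) =
      g.restrict A (g.edges_mem _ _ _ h).2 := by
  have hA : ((g.restrict Y (g.edges_mem _ _ _ h).1).root, f, A) ∈
      (g.restrict Y (g.edges_mem _ _ _ h).1).edges := ⟨h, Relation.ReflTransGen.refl⟩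
  exact (graphAlgebra_feat_of_edge Z hA).trans
    (OSFGraph.restrict_restrict _ (Relation.ReflTransGen.single ⟨f, h⟩) _)

theorem restrict_mem_closure {g : OSFGraph V S F} {Y : V} (hY : Y ∈ g.nodes) :
    g.restrict Y hY ∈ (graphAlgebra Z).closure {g} := by
  have h := g.reachable Y hY
  induction h with
  | refl =>
    rw [OSFGraph.restrict_root]
    exact Interp.subset_closure _ _ rfl
  | tail _ h ih =>
    obtain ⟨f, h⟩ := h
    rw [← graphAlgebra_feat_restrict Z h]
    exact Interp.feat_mem_closure _ _ _ (ih _)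

/-- The solution is the image under the morphism of the generic one, `Y ↦ g.restrict Y`. Newness of
the tags plays no role in this direction. -/
theorem exists_solves_of_hasMorphism {g : OSFGraph V S F} {I : Interp S F} {d : I.Dom}
    {β : unitInterval} (h : (graphAlgebra Z).HasMorphism I g d β) :
    ∃ α : V → I.Dom, α g.root = d ∧ I.Solves α β g := by
  classical
  obtain ⟨γ, ⟨h1, h2⟩, h3⟩ := h
  let α : V → I.Dom := fun Y =>
    -- The value outside the nodes is arbitrary, since `Solves` only looks at nodes.
    if hY : Y ∈ g.nodes then (γ ⟨g.restrict Y hY, restrict_mem_closure Z hY⟩).1 else d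
  have hα : ∀ Y (hY : Y ∈ g.nodes), α Y = (γ ⟨g.restrict Y hY, restrict_mem_closure Z hY⟩).1 :=
    fun Y hY => dif_pos hY
  refine ⟨α, ?_, fun Y f A h => ?_, fun Y hY => ?_⟩
  · rw [hα _ g.root_mem]
    refine Eq.trans (congrArg (fun x => (γ x).1) ?_) (congrArg Subtype.val h3)
    exact Subtype.ext g.restrict_root
  · have hm := g.edges_mem _ _ _ h
    rw [hα _ hm.1, hα _ hm.2]
    refine Eq.trans (congrArg (fun x => (γ x).1) ?_)
      (congrArg Subtype.val (h1 f ⟨g.restrict Y hm.1, restrict_mem_closure Z hm.1⟩))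
    exact Subtype.ext (graphAlgebra_feat_restrict Z h).symm
  · rw [hα _ hY]
    -- The subgraph at `Y` carries the label of `Y` to degree 1, so the morphism loses nothing
    -- beyond `β`.
    refine le_trans (le_inf ?_ le_rfl)
      (h2 (g.label Y) ⟨g.restrict Y hY, restrict_mem_closure Z hY⟩)
    change β ≤ sub ((g.restrict Y hY).label (g.restrict Y hY).root) (g.label Y)
    rw [OSFGraph.label_restrict_root, sub_refl]
    exact unitInterval.le_one'

/-- A word either follows a path of `g`, which `α` mirrors in `I`, or its last letter is undefined
at the graph reached before. The second case records that graph and letter, so that injectivity of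
the tags can recover them. -/
theorem word_graphAlgebra_cases {g : OSFGraph V S F} {I : Interp S F} {α : V → I.Dom}
    (hα : ∀ Y f A, (Y, f, A) ∈ g.edges → α A = I.feat f (α Y)) (w : List F) :
    (∃ Y, ∃ hY : Y ∈ g.nodes, (graphAlgebra Z).word w g = g.restrict Y hY ∧
        I.word w (α g.root) = α Y) ∨
      ∃ u f, ∃ h : (top : S) ≠ bot, w = u ++ [f] ∧
        (¬ ∃ Y, (OSFGraph.root ((graphAlgebra Z).word u g), f, Y) ∈
          OSFGraph.edges ((graphAlgebra Z).word u g)) ∧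
        (graphAlgebra Z).word w g =
          OSFGraph.trivialGraph (Z.tag f ((graphAlgebra Z).word u g)) h := by
  induction w using List.reverseRecOn with
  | nil => exact Or.inl ⟨g.root, g.root_mem, g.restrict_root.symm, rfl⟩
  | append_singleton u f ih =>
    by_cases hex : ∃ Y, (OSFGraph.root ((graphAlgebra Z).word u g), f, Y) ∈
        OSFGraph.edges ((graphAlgebra Z).word u g)
    · left
      rcases ih with ⟨Y, hY, h1, h2⟩ | ⟨u', f', h, -, -, h1⟩
      · rw [h1] at hex
        obtain ⟨A, hA⟩ := hex
        have hA' : (Y, f, A) ∈ g.edges := hA.1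
        refine ⟨A, (g.edges_mem _ _ _ hA').2, ?_, ?_⟩
        · exact (Interp.word_append_singleton (graphAlgebra Z) u f g).trans
            ((congrArg ((graphAlgebra Z).feat f) h1).trans (graphAlgebra_feat_restrict Z hA'))
        · rw [Interp.word_append_singleton, h2, hα _ _ _ hA']
      -- Impossible: a trivial graph has no edges to follow.
      · rw [h1] at hex
        obtain ⟨A, hA⟩ := hex
        exact hA.elim
    · right
      refine ⟨u, f, g.top_ne_bot, rfl, hex, ?_⟩
      exact (Interp.word_append_singleton (graphAlgebra Z) u f g).trans
        (graphAlgebra_feat_of_not_edge Z hex)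

variable {Z}

/-- The subalgebra of the graph algebra generated by `g` is free on `g`. -/
theorem hasMorphism_of_solves {g : OSFGraph V S F} (hnew : Z.NewFor g) {I : Interp S F}
    {α : V → I.Dom} {β : unitInterval} (h : I.Solves α β g) :
    (graphAlgebra Z).HasMorphism I g (α g.root) β := by
  refine Interp.HasMorphism.of_word ?_ ?_
  · intro w
    induction w using List.reverseRecOn with
    | nil =>
      intro w' hw
      rcases word_graphAlgebra_cases Z h.1 w' with ⟨Y, hY, h1, h2⟩ | ⟨u, f, ht, rfl, hn, h1⟩
      · have : g.root = Y := congrArg OSFGraph.root (hw.trans h1)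
        rw [h2, ← this]
        rfl
      -- A trivial graph is never a subgraph of `g`, because its node is new for `g`. The two mixed
      -- cases below are excluded in the same way.
      · have : g.root = Z.tag f _ := congrArg OSFGraph.root (hw.trans h1)
        exact absurd (this ▸ g.root_mem) (hnew _ (Interp.word_mem_closure (graphAlgebra Z) u g) f hn)
    | append_singleton v l ih =>
      intro w' hw
      rcases word_graphAlgebra_cases Z h.1 (v ++ [l]) with
        ⟨Y, hY, h1, h2⟩ | ⟨u, f, ht, hv, hn, h1⟩ <;>
      rcases word_graphAlgebra_cases Z h.1 w' with
        ⟨Y', hY', h1', h2'⟩ | ⟨u', f', ht', rfl, hn', h1'⟩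
      · have : Y = Y' := congrArg OSFGraph.root (h1.symm.trans (hw.trans h1'))
        rw [h2, h2', this]
      · have : Y = Z.tag f' _ := congrArg OSFGraph.root (h1.symm.trans (hw.trans h1'))
        exact absurd (this ▸ hY) (hnew _ (Interp.word_mem_closure (graphAlgebra Z) u' g) f' hn')
      · have : Z.tag f _ = Y' := congrArg OSFGraph.root (h1.symm.trans (hw.trans h1'))
        exact absurd (this ▸ hY') (hnew _ (Interp.word_mem_closure (graphAlgebra Z) u g) f hn)
      -- Equal trivial graphs come from the same feature applied to the same graph, so the words
      -- with their last letters removed already agree at `g` and the induction hypothesis applies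
      -- to them.
      · have : Z.tag f _ = Z.tag f' _ := congrArg OSFGraph.root (h1.symm.trans (hw.trans h1'))
        obtain ⟨rfl, hu⟩ := Z.tag_inj _ _ _ _ this
        obtain ⟨rfl, hf⟩ := List.append_inj' hv rfl
        obtain rfl : l = f := by simpa using hf
        rw [Interp.word_append_singleton, Interp.word_append_singleton, ih _ hu]
  · intro w s
    rcases word_graphAlgebra_cases Z h.1 w with ⟨Y, hY, h1, h2⟩ | ⟨u, f, ht, -, -, h1⟩
    · rw [h1, h2]
      change sub ((g.restrict Y hY).label (g.restrict Y hY).root) s ⊓ β ≤ _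
      rw [OSFGraph.label_restrict_root, inf_comm]
      exact (inf_le_inf_right _ (h.2 Y hY)).trans (I.sort_sub _ _ _)
    · rw [h1]
      exact inf_le_left.trans (I.sub_top_le_sort s _)

theorem hasMorphism_iff_exists_solves {g : OSFGraph V S F} (hnew : Z.NewFor g)
    {I : Interp S F} {d : I.Dom} {β : unitInterval} :
    (graphAlgebra Z).HasMorphism I g d β ↔ ∃ α : V → I.Dom, α g.root = d ∧ I.Solves α β g := by
  refine ⟨exists_solves_of_hasMorphism Z, ?_⟩
  rintro ⟨α, rfl, h⟩
  exact hasMorphism_of_solves hnew h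

end GraphAlgebra

/-! ### Terms and clauses as systems solved by assignments -/

section TermsAndClauses

variable {V S F : Type u} [FuzzyLattice S]

/-- The denotation is a minimum over all occurrences of subterms. At positive degree the indicator
at each child's root says exactly that `α` respects the feature leading to it. Normality is not
needed. -/
theorem Interp.le_denotAt_iff {I : Interp S F} {α : V → I.Dom} {β : unitInterval} (hβ : 0 < β)
    {t : OSFTerm V S F} {d : I.Dom} :
    β ≤ I.denotAt α t d ↔ d = α t.root ∧
      (∀ Y f Z, t.HasEdge Y f Z → α Z = I.feat f (α Y)) ∧
      ∀ Y s, t.HasSort Y s → β ≤ I.sort s (α Y) := by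
  induction t generalizing d with
  | node X s n f t ih =>
    simp only [denotAt, le_inf_iff, le_iInf_iff, le_ind_iff hβ, ih]
    constructor
    · rintro ⟨⟨rfl, hs⟩, ht⟩
      refine ⟨rfl, ?_, ?_⟩
      · rintro Y l Z ⟨p, s', n', f', r', i, h, rfl, rfl⟩
        generalize hu : OSFTerm.node Y s' n' f' r' = u at h
        cases h with
        | here =>
          simp only [OSFTerm.node.injEq] at hu
          obtain ⟨rfl, rfl, rfl, hf, hr⟩ := hu
          obtain rfl := eq_of_heq hf
          obtain rfl := eq_of_heq hr
          exact (ht i).1.symm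
        | child _ _ _ _ _ j p _ h =>
          subst hu
          exact (ht j).2.1 _ _ _ ⟨p, s', n', f', r', i, h, rfl, rfl⟩
      · rintro Y r ⟨p, u, h, rfl, rfl⟩
        cases h with
        | here => exact hs
        | child _ _ _ _ _ j p _ h => exact (ht j).2.2 _ _ ⟨p, u, h, rfl, rfl⟩
    · rintro ⟨rfl, he, hs⟩
      refine ⟨⟨rfl, hs _ _ ⟨[], _, OSFTerm.SubAt.here _, rfl, rfl⟩⟩, fun i => ⟨?_, ?_, ?_⟩⟩
      · exact (he _ _ _ ⟨[], s, n, f, t, i, OSFTerm.SubAt.here _, rfl, rfl⟩).symm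
      · rintro Y l Z ⟨p, s', n', f', r', j, h, rfl, rfl⟩
        exact he _ _ _ ⟨_, s', n', f', r', j, OSFTerm.SubAt.child X s n f t i p _ h, rfl, rfl⟩
      · rintro Y r ⟨p, u, h, rfl, rfl⟩
        exact hs _ _ ⟨_, u, OSFTerm.SubAt.child X s n f t i p _ h, rfl, rfl⟩

/-- All occurrences of a tag but at most one have the form `Y : ⊤`. As `⊤` holds to degree 1
everywhere, the constraints at all occurrences thus reduce to the single label of `Y`. -/
theorem OSFTerm.IsNormal.eq_sortOf_or_eq_top {t : OSFTerm V S F} (ht : t.IsNormal) {Y : V} {s : S}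
    (h : t.HasSort Y s) : s = t.sortOf Y ∨ s = top := by
  obtain ⟨p, u, hu, rfl, rfl⟩ := h
  obtain ⟨⟨q, v, hv, hvr, hvs⟩, hle⟩ := ht.isSortOf_sortOf (OSFTerm.mem_tags_of_subAt hu)
  by_cases hu' : u = leaf u.root top
  · right
    rw [hu']
    rfl
  by_cases hv' : v = leaf v.root top
  · right
    -- The most specific sort is `⊤` here, so every sort of this tag lies above `⊤` and equals it by
    -- antisymmetry.
    have htop : t.sortOf u.root = top := by rw [← hvs, hv']; rfl
    have h1 := hle _ ⟨p, u, hu, rfl, rfl⟩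
    rw [htop] at h1
    refine sub_antisymm _ _ ?_ h1
    rw [sub_top]
    exact zero_lt_one
  · left
    obtain rfl := ht.occ_unique hu hv hvr.symm hu' hv'
    rw [← hvs, OSFTerm.subAt_det hu hv]

theorem NormalTerm.le_denotAt_iff {I : Interp S F} {α : V → I.Dom} {β : unitInterval}
    (hβ : 0 < β) {ψ : NormalTerm V S F} {d : I.Dom} :
    β ≤ I.denotAt α ψ.1 d ↔ α ψ.toGraph.root = d ∧ I.Solves α β ψ.toGraph := by
  rw [Interp.le_denotAt_iff hβ]
  refine and_congr eq_comm (and_congr Iff.rfl ⟨fun h Y hY => ?_, fun h Y s hs => ?_⟩)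
  · exact h _ _ (ψ.2.isSortOf_sortOf hY).1
  · rcases ψ.2.eq_sortOf_or_eq_top hs with rfl | rfl
    · obtain ⟨p, u, hu, rfl, -⟩ := hs
      exact h _ (OSFTerm.mem_tags_of_subAt hu)
    · rw [I.sort_top]
      exact unitInterval.le_one'

/-- Features are total functions and every node is reachable, so the value at the root determines
the assignment on the nodes. -/
theorem Interp.eq_of_edges {I : Interp S F} {g : OSFGraph V S F} {α α' : V → I.Dom}
    (h : ∀ Y f Z, (Y, f, Z) ∈ g.edges → α Z = I.feat f (α Y))
    (h' : ∀ Y f Z, (Y, f, Z) ∈ g.edges → α' Z = I.feat f (α' Y))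
    (hr : α g.root = α' g.root) {Y : V} (hY : Y ∈ g.nodes) : α Y = α' Y := by
  have hY' := g.reachable Y hY
  clear hY
  induction hY' with
  | refl => exact hr
  | tail _ e ih =>
    obtain ⟨f, e⟩ := e
    rw [h _ _ _ e, h' _ _ _ e, ih]

/-- The supremum over assignments is attained when positive: assignments of positive degree at `d`
agree on all tags of the term, hence have the same degree. -/
theorem NormalTerm.le_denot_iff {I : Interp S F} {β : unitInterval} (hβ : 0 < β)
    {ψ : NormalTerm V S F} {d : I.Dom} :
    β ≤ I.denot ψ.1 d ↔
      ∃ α : V → I.Dom, α ψ.toGraph.root = d ∧ I.Solves α β ψ.toGraph := by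
  constructor
  · intro h
    -- Any assignment of positive degree will do; it is shown to dominate all the others.
    obtain ⟨α, hα⟩ := lt_iSup_iff.1 (lt_of_lt_of_le hβ h)
    refine ⟨α, (NormalTerm.le_denotAt_iff hβ).1 (h.trans (iSup_le fun α' => ?_))⟩
    rcases eq_or_lt_of_le (unitInterval.nonneg' (t := I.denotAt α' ψ.1 d)) with h0 | h0
    · rw [← h0]
      exact unitInterval.nonneg'
    · obtain ⟨hr, he, -⟩ := (NormalTerm.le_denotAt_iff hα).1 le_rfl
      obtain ⟨hr', he', hs'⟩ := (NormalTerm.le_denotAt_iff h0).1 le_rfl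
      refine (NormalTerm.le_denotAt_iff h0).2 ⟨hr, he, fun Y hY => ?_⟩
      rw [Interp.eq_of_edges he he' (hr.trans hr'.symm) hY]
      exact hs' Y hY
  · rintro ⟨α, h⟩
    exact ((NormalTerm.le_denotAt_iff hβ).2 h).trans (le_iSup (fun α => I.denotAt α ψ.1 d) α)

theorem NormalTerm.sat_toClause_iff {I : Interp S F} {α : V → I.Dom} {β : unitInterval}
    (hβ : 0 < β) {ψ : NormalTerm V S F} :
    I.Sat α β ψ.toClause.clause ↔ I.Solves α β ψ.toGraph := by
  constructor
  · intro h
    exact ⟨fun Y f Z he => (le_ind_iff hβ).1 (h _ (OSFTerm.mem_clauseOf.2 (.inr ⟨Y, f, Z, he, rfl⟩))),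
      fun Y hY => h _ (OSFTerm.mem_clauseOf.2 (.inl ⟨Y, hY, rfl⟩))⟩
  · rintro ⟨he, hs⟩ c hc
    rcases OSFTerm.mem_clauseOf.1 hc with ⟨Y, hY, rfl⟩ | ⟨Y, f, Z, h, rfl⟩
    · exact hs Y hY
    · exact (le_ind_iff hβ).2 (he _ _ _ h)

/-- Covers degree 0, where satisfaction says nothing about a solution. -/
theorem Interp.sat_zero (I : Interp S F) (α : V → I.Dom) (φ : Clause V S F) : I.Sat α 0 φ := by
  intro c _
  cases c <;> exact unitInterval.nonneg'

open Classical in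
theorem Interp.sat_subst_iff {I : Interp S F} {α : V → I.Dom} {β : unitInterval}
    {φ : Clause V S F} {X Y : V} :
    I.Sat α β (φ.subst X Y) ↔ I.Sat (fun A => α (if A = Y then X else A)) β φ := by
  simp only [Sat, Clause.subst, Finset.forall_mem_image]
  refine forall₂_congr fun c _ => ?_
  cases c <;> rfl

end TermsAndClauses

/-! ### Equality of the three degrees -/

section Equivalence

variable {V S F : Type u} [FuzzyLattice S] {Z : NewTags V S F} {ψ ψ' : NormalTerm V S F}

theorem termSub_eq_approx (hnew : Z.NewFor ψ.toGraph) (hnew' : Z.NewFor ψ'.toGraph) :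
    termSub ψ'.1 ψ.1 = (graphAlgebra Z).approx ψ.toGraph ψ'.toGraph := by
  refine sSup_eq_of_pos fun β hβ => ?_
  change (∀ (I : Interp S F) (d : I.Dom), I.denot ψ'.1 d ⊓ β ≤ I.denot ψ.1 d) ↔
    (graphAlgebra Z).HasMorphism (graphAlgebra Z) ψ.toGraph ψ'.toGraph β
  constructor
  · intro h
    -- By the identity morphism, `ψ'` has denotation 1 at its own graph; the subsumption is tested
    -- at this element.
    have h1 := (NormalTerm.le_denot_iff zero_lt_one).2
      ((hasMorphism_iff_exists_solves hnew').1
        (Interp.HasMorphism.refl (graphAlgebra Z) ψ'.toGraph 1))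
    exact (hasMorphism_iff_exists_solves hnew).2 ((NormalTerm.le_denot_iff hβ).1
      (le_trans (le_inf (unitInterval.le_one'.trans h1) le_rfl) (h _ _)))
  · intro h I d
    rcases eq_or_lt_of_le (unitInterval.nonneg' (t := I.denot ψ'.1 d)) with h0 | h0
    · rw [← h0]
      exact inf_le_left.trans unitInterval.nonneg'
    · rw [inf_comm, NormalTerm.le_denot_iff (lt_inf_iff.2 ⟨hβ, h0⟩),
        ← hasMorphism_iff_exists_solves hnew]
      -- What remains is a morphism from the graph of `ψ'` to `d`, whose degree is the denotation of
      -- `ψ'` at `d`.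
      refine h.trans ?_
      rw [hasMorphism_iff_exists_solves hnew', ← NormalTerm.le_denot_iff h0]

theorem rootedImpl_eq_approx (hdisj : Disjoint ψ.1.tags ψ'.1.tags)
    (hnew : Z.NewFor ψ.toGraph) (hnew' : Z.NewFor ψ'.toGraph) :
    rootedImpl ψ'.toClause.toRootedClause ψ.toClause.toRootedClause =
      (graphAlgebra Z).approx ψ.toGraph ψ'.toGraph := by
  classical
  have htags : ∀ ψ : NormalTerm V S F, ψ.toClause.clause.tags = ψ.1.tags :=
    fun ψ => ψ.1.tags_clauseOf
  refine sSup_eq_of_pos fun β hβ => ?_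
  change ImpliesAt ψ'.toClause.clause (ψ.toClause.clause.subst ψ'.1.root ψ.1.root) β ↔
    (graphAlgebra Z).HasMorphism (graphAlgebra Z) ψ.toGraph ψ'.toGraph β
  constructor
  · intro h
    -- The generic solution of the graph of `ψ'` in the graph algebra, at degree 1.
    obtain ⟨α, hα, hs⟩ := (hasMorphism_iff_exists_solves hnew').1
      (Interp.HasMorphism.refl (graphAlgebra Z) ψ'.toGraph 1)
    obtain ⟨α', h1, h2⟩ := h _ α 1 ((NormalTerm.sat_toClause_iff zero_lt_one).2 hs)
    rw [inf_eq_right.2 unitInterval.le_one', Interp.sat_subst_iff,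
      NormalTerm.sat_toClause_iff hβ] at h2
    refine (hasMorphism_iff_exists_solves hnew).2 ⟨_, ?_, h2⟩
    change α' (if ψ.1.root = ψ.1.root then ψ'.1.root else ψ.1.root) = _
    -- The root of `ψ'` is a tag of both clauses after the substitution, so `α'` keeps the value of
    -- `α` there.
    rw [if_pos rfl, h1 _ ⟨by rw [htags]; exact ψ'.1.root_mem_tags, ?_⟩]
    · exact hα
    · simp only [Clause.tags, Clause.subst, Set.mem_iUnion, exists_prop, Finset.mem_image]
      exact ⟨_, ⟨_, OSFTerm.mem_clauseOf.2 (.inl ⟨_, ψ.1.root_mem_tags, rfl⟩), rfl⟩,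
        (if_pos rfl).symm⟩
  · intro h I α δ hα
    rcases eq_or_lt_of_le (unitInterval.nonneg' (t := δ)) with h0 | h0
    · refine ⟨α, fun _ _ => rfl, ?_⟩
      rw [← h0, inf_eq_left.2 unitInterval.nonneg']
      exact I.sat_zero _ _
    · have hlt : 0 < β ⊓ δ := lt_inf_iff.2 ⟨hβ, h0⟩
      obtain ⟨α₀, hr, hs⟩ := (hasMorphism_iff_exists_solves hnew).1
        (h.trans ((hasMorphism_iff_exists_solves hnew').2
          ⟨α, rfl, (NormalTerm.sat_toClause_iff h0).1 hα⟩))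
      have hαr : ∀ A ∈ ψ.1.tags, A ≠ ψ'.1.root := fun A hA hAr =>
        Set.disjoint_left.1 hdisj hA (hAr ▸ ψ'.1.root_mem_tags)
      -- By disjointness the root of `ψ'` is the only tag that the clauses share after substitution.
      -- Overwriting `α₀` there secures agreement with `α` and does not disturb the tags of `ψ`.
      refine ⟨fun A => if A = ψ'.1.root then α ψ'.1.root else α₀ A, ?_, ?_⟩
      · rintro A ⟨hA', hA⟩
        rw [htags] at hA'
        rcases Clause.mem_tags_subst hA with rfl | hA
        · exact if_pos rfl
        · rw [htags] at hA
          exact absurd hA' (Set.disjoint_left.1 hdisj hA)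
      -- Pulled back along the substitution, the new assignment is `α₀` on the tags of `ψ`; at the
      -- root of `ψ` this is `hr`.
      · have key : ∀ A ∈ ψ.1.tags,
            (if (if A = ψ.1.root then ψ'.1.root else A) = ψ'.1.root then α ψ'.1.root
              else α₀ (if A = ψ.1.root then ψ'.1.root else A)) = α₀ A := by
          intro A hA
          by_cases hAr : A = ψ.1.root
          · rw [if_pos (if_pos hAr), hAr]
            exact hr.symm
          · rw [if_neg hAr, if_neg (hαr A hA)]
        rw [Interp.sat_subst_iff, inf_comm, NormalTerm.sat_toClause_iff hlt]
        refine ⟨fun Y f A he => ?_, fun Y hY => ?_⟩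
        · have hm := ψ.toGraph.edges_mem _ _ _ he
          simp only [key _ hm.1, key _ hm.2]
          exact hs.1 _ _ _ he
        · simp only [key _ hY]
          exact hs.2 _ hY

end Equivalence

end OSF

theorem mainTheorem1 {V S F : Type u} [Infinite V] [Finite S] [OSF.FuzzyLattice S]
    (Z : OSF.NewTags V S F)
    (ψ ψ' : OSF.NormalTerm V S F) (g g' : OSF.OSFGraph V S F)
    (φ φ' : OSF.RootedSolvedClause V S F)
    (hdisj : Disjoint ψ.1.tags ψ'.1.tags)
    (hg : ψ.toGraph = g) (hg' : ψ'.toGraph = g')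
    (hφ : ψ.toClause = φ) (hφ' : ψ'.toClause = φ')
    (hnew : Z.NewFor g) (hnew' : Z.NewFor g')
    (β : unitInterval) :
    List.TFAE [
      (OSF.graphAlgebra Z).approx g g' = β,
      OSF.termSub ψ'.1 ψ.1 = β,
      OSF.rootedImpl φ'.toRootedClause φ.toRootedClause = β] := by
  subst hg hg' hφ hφ'
  rw [OSF.termSub_eq_approx hnew hnew', OSF.rootedImpl_eq_approx hdisj hnew hnew']
  simp
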